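/- Let $F:\mathbb{R}^n\to\mathbb{R}^n$ be a topical map, that is, $F(h+\mu\mathbf{1})=F(h)+\mu\mathbf{1}$ for all $h\in\mathbb{R}^n$ and $\mu\in\mathbb{R}$ (where $\mathbf{1}=(1,\dots,1)$), and $F(h)\le F(g)$ whenever $h\le g$ coordinatewise. Let $\mathscr{G}'(F)$ be the directed graph with vertices $1,\dots,n$ and an edge from $i$ to $j$ if and only if $\lim_{\alpha\to+\infty}[F(\alpha e_j)]_i=+\infty$, where $e_j$ is the $j$-th standard basis vector. Suppose that $\mathscr{G}'(F)$ is strongly connected, meaning that for any two vertices $i\neq j$ there are a directed path from $i$ to $j$ and a directed path from $j$ to $i$. Then $F$ has an additive eigenvector: there are $h\in\mathbb{R}^n$ and $\mu\in\mathbb{R}$ such that $F^k(h)=h+k\mu\mathbf{1}$ for all integers $k\ge 0$; in particular $F(h)=h+\mu\mathbf{1}$. -/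

import Mathlib

/-- A topical map on `ℝⁿ`: constant additivity and monotonicity (coordinatewise order);
`fun i => c + h i` is the vector `h` shifted by the constant `c`. -/
structure IsTopical {n : ℕ} (F : (Fin n → ℝ) → (Fin n → ℝ)) : Prop where
  const_add : ∀ (c : ℝ) (h : Fin n → ℝ), F (fun i => c + h i) = fun i => c + F h i
  mono : ∀ h g : Fin n → ℝ, h ≤ g → F h ≤ F g

/-- The directed graph associated with `F`: an edge from `i` to `j` if
`[F (α 1_j)](i) → +∞` as `α → +∞`, where `1_j` is the indicator of `j`. -/
def topicalGraph {n : ℕ} (F : (Fin n → ℝ) → (Fin n → ℝ)) : Digraph (Fin n) where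
  Adj i j :=
    Filter.Tendsto (fun α : ℝ => F (α • ({j} : Set (Fin n)).indicator (1 : Fin n → ℝ)) i)
      Filter.atTop Filter.atTop

/-- `j` is accessible from `i`: `i = j`, or there is a directed path from `i` to `j`. -/
def Accessible {V : Type*} (G : Digraph V) (i j : V) : Prop :=
  Relation.ReflTransGen G.Adj i j

/-- Two vertices communicate if each is accessible from the other. -/
def Communicate {V : Type*} (G : Digraph V) (i j : V) : Prop :=
  Accessible G i j ∧ Accessible G j i

/-- Any two vertices communicate. -/
def IsStronglyConnectedDigraph {V : Type*} (G : Digraph V) : Prop :=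
  ∀ i j : V, Communicate G i j

/-- `h` is an additive eigenvector of `F` with eigenvalue `c`: `F^k h = h + k c` for all
`k = 0, 1, 2, …`. -/
def IsAdditiveEigenvector {n : ℕ} (F : (Fin n → ℝ) → (Fin n → ℝ)) (h : Fin n → ℝ) (c : ℝ) :
    Prop :=
  ∀ k : ℕ, F^[k] h = fun i => h i + k * c

open Filter Topology

namespace IsTopical

variable {n : ℕ} {F : (Fin n → ℝ) → (Fin n → ℝ)}

/-! Vanishing discount. For `l < 1` the map `h ↦ F (l • h)` is a sup-norm contraction; shifting its
fixed point to minimum `0` gives `F (l • u) = u + c` with `|c| ≤ ‖F 0‖`. Along an edge `i → j`, a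
large `u j` forces `F (l • u) i`, hence `u i`, to be large. So bounds spread from a zero coordinate
to all others (`exists_uniform_bound`), uniformly in `l ≥ 1/2`. By compactness some sequence `(u,
c)` converges as `l → 1`, and continuity of `F` makes the limit an eigenpair. -/

/-- Topical maps are nonexpansive in the sup norm. -/
theorem lipschitzWith (hF : IsTopical F) : LipschitzWith 1 F := by
  have key : ∀ (h g : Fin n → ℝ) (i : Fin n), F h i ≤ dist h g + F g i := by
    intro h g i
    have hle : h ≤ fun j => dist h g + g j := fun j => by
      have h1 := dist_le_pi_dist h g j
      rw [Real.dist_eq] at h1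
      linarith [le_abs_self (h j - g j)]
    have h2 := hF.mono _ _ hle i
    rwa [hF.const_add] at h2
  refine LipschitzWith.of_dist_le_mul fun h g => ?_
  rw [NNReal.coe_one, one_mul, dist_pi_le_iff dist_nonneg]
  intro i
  rw [Real.dist_eq, abs_le]
  have h1 := key h g i
  have h2 := key g h i
  rw [dist_comm] at h2
  constructor <;> linarith

/-- For `l < 1` the discounted map `h ↦ F (l • h)` has a fixed point. -/
theorem exists_discounted_fixedPoint (hF : IsTopical F) {l : ℝ} (h0 : 0 ≤ l) (h1 : l < 1) :
    ∃ h, F (l • h) = h := by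
  have hc : ContractingWith ⟨l, h0⟩ (fun h => F (l • h)) := by
    refine ⟨by exact_mod_cast h1, LipschitzWith.of_dist_le_mul fun x y => ?_⟩
    have h2 := hF.lipschitzWith.dist_le_mul (l • x) (l • y)
    rw [dist_smul₀, Real.norm_of_nonneg h0, NNReal.coe_one, one_mul] at h2
    exact h2
  exact ⟨_, hc.fixedPoint_isFixedPt⟩

/-- Normalizing the discounted fixed point so that its least coordinate is `0`. -/
theorem exists_normalized_discounted (hF : IsTopical F) [NeZero n] {l : ℝ} (h0 : 0 ≤ l)
    (h1 : l < 1) :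
    ∃ (u : Fin n → ℝ) (c : ℝ), 0 ≤ u ∧ (∃ i, u i = 0) ∧ |c| ≤ ‖F 0‖ ∧
      F (l • u) = fun i => u i + c := by
  obtain ⟨h, hh⟩ := hF.exists_discounted_fixedPoint h0 h1
  obtain ⟨i₀, hi₀⟩ := Finite.exists_min h
  have hnorm : (1 - l) * ‖h‖ ≤ ‖F 0‖ := by
    have h2 := hF.lipschitzWith.dist_le_mul (l • h) 0
    rw [hh, NNReal.coe_one, one_mul, dist_zero_right, norm_smul, Real.norm_of_nonneg h0,
      dist_eq_norm] at h2
    linarith [norm_sub_norm_le h (F 0)]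
  -- With `m = h i₀`, `F (l • (h - m)) = h - l * m = (h - m) + (1 - l) * m`.
  refine ⟨fun i => h i - h i₀, (1 - l) * h i₀, fun i => sub_nonneg.2 (hi₀ i),
    ⟨i₀, sub_self _⟩, ?_, ?_⟩
  · rw [abs_mul, abs_of_pos (sub_pos.2 h1)]
    exact (mul_le_mul_of_nonneg_left (norm_le_pi_norm h i₀) (sub_pos.2 h1).le).trans hnorm
  · have h3 := hF.const_add (-(l * h i₀)) (l • h)
    have h4 : (fun i => -(l * h i₀) + (l • h) i) = l • fun i => h i - h i₀ := by
      ext i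
      simp only [Pi.smul_apply, smul_eq_mul]
      ring
    rw [h4, hh] at h3
    rw [h3]
    ext i
    ring

/-- Bounds on discounted subsolutions propagate along directed paths of the graph of `F`. -/
theorem exists_bound_of_accessible (hF : IsTopical F) (C : ℝ) {i j : Fin n}
    (hij : Accessible (topicalGraph F) i j) :
    ∀ B : ℝ, ∃ A : ℝ, ∀ (l : ℝ) (u : Fin n → ℝ), 1 / 2 ≤ l → 0 ≤ u →
      (∀ k, F (l • u) k ≤ u k + C) → u i ≤ B → u j ≤ A := by
  induction hij with
  | refl => exact fun B => ⟨B, fun _ _ _ _ _ h => h⟩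
  | @tail j k _ hjk ih =>
    intro B
    obtain ⟨A, hA⟩ := ih B
    have ht : Tendsto (fun α : ℝ => F (α • ({k} : Set (Fin n)).indicator (1 : Fin n → ℝ)) j)
      atTop atTop := hjk
    obtain ⟨α, hα0, hα⟩ := ((eventually_ge_atTop 0).and
      (ht.eventually (eventually_gt_atTop (A + C)))).exists
    -- Since `l ≥ 1/2`, `u k > 2 * α` would put `l • u` above `α` times the indicator of `k`, so `F
    -- (l • u) j > A + C ≥ u j + C`.
    refine ⟨2 * α, fun l u hl hu hs hi => ?_⟩
    by_contra! hk
    have hle : α • ({k} : Set (Fin n)).indicator (1 : Fin n → ℝ) ≤ l • u := by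
      intro m
      have hm : 0 ≤ u m := hu m
      by_cases hmk : m = k
      · subst hmk
        simp only [Pi.smul_apply, smul_eq_mul, Set.indicator_of_mem (Set.mem_singleton m),
          Pi.one_apply, mul_one]
        nlinarith
      · simp only [Pi.smul_apply, smul_eq_mul,
          Set.indicator_of_notMem (Set.mem_singleton_iff.not.2 hmk), mul_zero]
        exact mul_nonneg (by linarith) hm
    linarith [hF.mono _ _ hle j, hs j, hA l u hl hu hs hi]

/-- Strong connectivity bounds all normalized discounted subsolutions uniformly. -/
theorem exists_uniform_bound (hF : IsTopical F)
    (hG : IsStronglyConnectedDigraph (topicalGraph F)) (C : ℝ) :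
    ∃ A : ℝ, ∀ (l : ℝ) (u : Fin n → ℝ), 1 / 2 ≤ l → 0 ≤ u →
      (∀ k, F (l • u) k ≤ u k + C) → (∃ i, u i = 0) → ∀ j, u j ≤ A := by
  choose A hA using fun i j => hF.exists_bound_of_accessible C (hG i j).1 0
  obtain ⟨M, hM⟩ := (Set.finite_range fun p : Fin n × Fin n => A p.1 p.2).bddAbove
  refine ⟨M, fun l u hl hu hs ⟨i, hi⟩ j => ?_⟩
  exact (hA i j l u hl hu hs hi.le).trans (hM ⟨(i, j), rfl⟩)

theorem exists_eq_add_const (hF : IsTopical F) [NeZero n]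
    (hG : IsStronglyConnectedDigraph (topicalGraph F)) :
    ∃ (h : Fin n → ℝ) (c : ℝ), F h = fun i => c + h i := by
  -- The halving keeps `l` in `[1/2, 1)`, where the uniform bound applies.
  let l : ℕ → ℝ := fun k => 1 - 1 / ((k : ℝ) + 1) / 2
  have hl2 : ∀ k, 1 / 2 ≤ l k := fun k => by
    have : 1 / ((k : ℝ) + 1) ≤ 1 := by
      rw [div_le_one (by positivity)]
      linarith [(Nat.cast_nonneg k : (0 : ℝ) ≤ k)]
    simp only [l]
    linarith
  have hl1 : ∀ k, l k < 1 := fun k => by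
    have : 0 < 1 / ((k : ℝ) + 1) / 2 := by positivity
    simp only [l]
    linarith
  have hl : Tendsto l atTop (𝓝 1) := by
    simpa [l] using ((tendsto_one_div_add_atTop_nhds_zero_nat (𝕜 := ℝ)).div_const 2).const_sub 1
  choose u c hu hu0 hc hF' using fun k =>
    hF.exists_normalized_discounted (by linarith [hl2 k]) (hl1 k)
  obtain ⟨A, hA⟩ := hF.exists_uniform_bound hG ‖F 0‖
  have hmem : ∀ k, (u k, c k) ∈
      Set.Icc (0 : Fin n → ℝ) (fun _ => A) ×ˢ Set.Icc (-‖F 0‖) ‖F 0‖ := fun k =>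
    ⟨⟨hu k, hA (l k) (u k) (hl2 k) (hu k)
      (fun i => by rw [hF' k]; linarith [le_of_abs_le (hc k)]) (hu0 k)⟩, abs_le.1 (hc k)⟩
  obtain ⟨⟨h, μ⟩, -, φ, hφ, hlim⟩ := (isCompact_Icc.prod isCompact_Icc).tendsto_subseq hmem
  have hh : Tendsto (fun k => u (φ k)) atTop (𝓝 h) := (continuous_fst.tendsto _).comp hlim
  have hμ : Tendsto (fun k => c (φ k)) atTop (𝓝 μ) := (continuous_snd.tendsto _).comp hlim
  have hleft : Tendsto (fun k => F (l (φ k) • u (φ k))) atTop (𝓝 (F h)) := by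
    refine (hF.lipschitzWith.continuous.tendsto h).comp ?_
    simpa using (hl.comp hφ.tendsto_atTop).smul hh
  refine ⟨h, μ, funext fun i => tendsto_nhds_unique ((tendsto_pi_nhds.1 hleft) i) ?_⟩
  simp only [hF']
  rw [add_comm]
  exact ((tendsto_pi_nhds.1 hh) i).add hμ

theorem isAdditiveEigenvector (hF : IsTopical F) {h : Fin n → ℝ} {c : ℝ}
    (hc : F h = fun i => c + h i) : IsAdditiveEigenvector F h c := by
  intro k
  induction k with
  | zero => simp
  | succ k ih =>
    have h1 := hF.const_add (k * c) h
    rw [Function.iterate_succ_apply', ih]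
    simp only [add_comm (h _)]
    rw [h1, hc]
    ext i
    push_cast
    ring

end IsTopical

theorem mainTheorem4 (n : ℕ) (F : (Fin n → ℝ) → (Fin n → ℝ)) (hF : IsTopical F)
    (hG : IsStronglyConnectedDigraph (topicalGraph F)) :
    ∃ (h : Fin n → ℝ) (c : ℝ), IsAdditiveEigenvector F h c := by
  rcases Nat.eq_zero_or_pos n with rfl | hn
  · exact ⟨0, 0, fun _ => Subsingleton.elim _ _⟩
  · have : NeZero n := ⟨hn.ne'⟩
    obtain ⟨h, c, hc⟩ := hF.exists_eq_add_const hG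
    exact ⟨h, c, hF.isAdditiveEigenvector hc⟩
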